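/- Let $(X,d)$ be a complete metric space, $I$ a finite set, and $(f_i)_{i\in I}$ a family of continuous maps $f_i:X\to X$. For $x\in X$ let the orbit $\mathcal O(x)$ be the set of all points $f_{i_1}\circ\cdots\circ f_{i_n}(x)$ with $n\ge 0$ and $i_1,\dots,i_n\in I$ (so $x\in\mathcal O(x)$). Assume that there is $C\in[0,1)$ such that $$d(f_i(y),f_i(z))\le C\,d(y,z)\qquad\text{for all } x\in X,\ i\in I,\ y,z\in\mathcal O(x).$$ Let $(\rho_i)_{i\in I}$ be an admissible system of grey level maps: each $\rho_i:[0,1]\to[0,1]$ is not identically zero, non-decreasing and right-continuous, $\rho_i(0)=0$ for all $i\in I$, and $\rho_i(1)=1$ for some $i\in I$. For a fuzzy set $u:X\to[0,1]$ put $[u]^\alpha=\{x: u(x)\ge\alpha\}$ for $\alpha\in(0,1]$ and $[u]^0=\operatorname{supp}u=\overline{\{x:u(x)>0\}}$. Let $\mathcal F_{\mathcal S}^*$ be the set of all upper semicontinuous $u:X\to[0,1]$ with compact support that take the value $1$ somewhere and such that for every $x\in X$ with $u(x)>0$ there are $w\in X$ and $y\in\overline{\mathcal O(w)}$ with $x\in\overline{\mathcal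 O(w)}$ and $u(y)=1$. Let $d_\infty(u,v)=\sup_{\alpha\in[0,1]}h([u]^\alpha,[v]^\alpha)$, where $h$ is the Hausdorff–Pompeiu distance. Define $$Z(u)(y)=\max_{i\in I}\rho_i\bigl(f_i(u)(y)\bigr),\qquad f_i(u)(y)=\sup\{u(x): f_i(x)=y\}\quad(\sup\emptyset=0),$$ and $F_{\mathcal S}(K)=\bigcup_{i\in I}f_i(K)$ for $K\subseteq X$. Then $Z$ is a weakly Picard operator on $(\mathcal F_{\mathcal S}^*,d_\infty)$: $Z$ maps $\mathcal F_{\mathcal S}^*$ into itself, and for every $u\in\mathcal F_{\mathcal S}^*$ the sequence $(Z^n(u))_{n}$ converges in $d_\infty$ to some $\mathbf u_u\in\mathcal F_{\mathcal S}^*$ with $Z(\mathbf u_u)=\mathbf u_u$. Moreover, for every $u\in\mathcal F_{\mathcal S}^*$ and every $m\ge 0$, the limit satisfies $$d_\infty\bigl(Z^m(u),\mathbf u_u\bigr)\le\frac{C^m}{1-C}\,\operatorname{diam}\bigl(F_{\mathcal S}(\operatorname{supp}u)\cup\operatorname{supp}u\bigr).$$ -/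

import Mathlib

open Set Filter Topology
open scoped ENNReal unitInterval

namespace OrbitalFuzzy

/-! ### Fuzzy sets

A fuzzy subset of `X` is a function `u : X → I`, where `I = [0,1]` is Mathlib's `unitInterval`. -/

section FuzzySets

variable {X : Type*} [MetricSpace X]

/-- The support of a fuzzy set: the closure of the set where it is positive. -/
def fuzzySupp (u : X → I) : Set X := closure {x | 0 < u x}

open Classical in
/-- The `α`-cut: `{x | α ≤ u x}` for `α ∈ (0,1]`, and the support for `α = 0`. -/
def cut (u : X → I) (α : I) : Set X :=
  if α = 0 then fuzzySupp u else {x | α ≤ u x}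

/-- `F_X^{**}`: the normal, compactly supported fuzzy sets. -/
def normalCompact (X : Type*) [MetricSpace X] : Set (X → I) :=
  {u | (∃ x, u x = 1) ∧ IsCompact (fuzzySupp u)}

/-- `F_X^*`: the normal, compactly supported, upper semicontinuous fuzzy sets. -/
def normalCompactUsc (X : Type*) [MetricSpace X] : Set (X → I) :=
  {u | u ∈ normalCompact X ∧ UpperSemicontinuous u}

/-- `d_∞(u,v) = sup_{α ∈ [0,1]} h([u]^α, [v]^α)`, with `h` the Hausdorff-Pompeiu distance.
It is written with values in `[0,∞]`, so that a bound by a real number includes finiteness. -/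
noncomputable def dInf (u v : X → I) : ℝ≥0∞ :=
  ⨆ α : I, Metric.hausdorffEDist (cut u α) (cut v α)

/-- Zadeh's extension principle: `f(u)(y) = sup {u x | f x = y}`, which is the bottom element `0`
of `[0,1]` when `y` is not in the range of `f`. -/
noncomputable def zadeh (f : X → X) (u : X → I) : X → I :=
  fun y => ⨆ (x : X) (_ : f x = y), u x

end FuzzySets

/-! ### Grey level maps -/

/-- A non-decreasing, right-continuous, nonzero map `[0,1] → [0,1]`. -/
structure IsNdrc (ρ : I → I) : Prop where
  nonzero : ∃ t, ρ t ≠ 0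
  monotone : Monotone ρ
  rightCont : ∀ t, ContinuousWithinAt ρ (Ici t) t

/-- An admissible system of grey level maps. -/
structure IsAdmissible {ι : Type*} (ρ : ι → I → I) : Prop where
  ndrc : ∀ i, IsNdrc (ρ i)
  map_zero : ∀ i, ρ i 0 = 0
  map_one : ∃ i, ρ i 1 = 1

/-! ### Orbital contractive iterated function systems -/

section IFS

variable {X ι : Type*}

/-- `f_ω = f_{ω₁} ∘ ⋯ ∘ f_{ωₙ}` for a finite word `ω`, the empty word giving the identity. -/
def wordMap (f : ι → X → X) (ω : List ι) (x : X) : X := ω.foldr f x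

/-- The orbit `O(x)`: the images of `x` under all `f_ω`, `ω` a finite word (so `x ∈ O(x)`). -/
def orbit (f : ι → X → X) (x : X) : Set X := {y | ∃ ω : List ι, wordMap f ω x = y}

/-- The fractal operator `F_S(K) = ⋃ i, f_i(K)`. -/
def fractalOperator (f : ι → X → X) (K : Set X) : Set X := ⋃ i, f i '' K

variable [MetricSpace X]

/-- The maps are continuous and contract with the constant `C ∈ [0,1)` on each orbit. -/
structure IsOrbitalContractive (f : ι → X → X) (C : ℝ) : Prop where
  continuous : ∀ i, Continuous (f i)
  nonneg : 0 ≤ C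
  lt_one : C < 1
  contract : ∀ x, ∀ i, ∀ y ∈ orbit f x, ∀ z ∈ orbit f x,
    dist (f i y) (f i z) ≤ C * dist y z

/-- The fuzzy Hutchinson-Barnsley operator `Z(u) = ⋁ i, ρ_i(f_i(u))`. -/
noncomputable def fuzzyOperator (f : ι → X → X) (ρ : ι → I → I) (u : X → I) : X → I :=
  fun y => ⨆ i, ρ i (zadeh (f i) u y)

/-- `F_S^{**}`: the fuzzy sets in `F_X^{**}` such that every point where `u` is positive lies in
the closure of an orbit that also contains, in its closure, a point where `u` is `1`. -/
def orbitalNormalCompact (f : ι → X → X) : Set (X → I) :=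
  {u | u ∈ normalCompact X ∧ ∀ x, 0 < u x →
    ∃ w, ∃ y ∈ closure (orbit f w), x ∈ closure (orbit f w) ∧ u y = 1}

/-- `F_S^*`: the upper semicontinuous elements of `F_S^{**}`. -/
def orbitalNormalCompactUsc (f : ι → X → X) : Set (X → I) :=
  {u | u ∈ orbitalNormalCompact f ∧ UpperSemicontinuous u}

end IFS

/-- `T` is a weakly Picard operator on `S` with respect to the distance `d`: it maps `S` to itself
and, for each starting point in `S`, the iterates converge to a fixed point of `T` in `S`. -/
def IsWeaklyPicardOn {Y : Type*} (d : Y → Y → ℝ≥0∞) (T : Y → Y) (S : Set Y) : Prop :=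
  MapsTo T S S ∧ ∀ u ∈ S, ∃ v ∈ S, T v = v ∧ Tendsto (fun n : ℕ => d (T^[n] u) v) atTop (𝓝 0)

end OrbitalFuzzy

namespace OrbitalFuzzy

/-! ### Horizontal closeness of fuzzy sets and the distance `dInf`. -/

section FuzzySets

variable {X : Type*} [MetricSpace X]

/-! Distances are controlled through hypographs: if each point of either fuzzy set can be moved by
at most `ε` to a point where the other is at least as high (`Near` both ways), all cuts are
`ε`-close at once.

A positive value of `Z^n u` has the form `ρ_ω (u x)` at `f_ω x`, with `ω` a word of length `n`. The
orbit condition supplies a point `z` of height `1` in an orbit closure containing `x`. Replacing `x`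
by `z`, or by `f_j z` with `ρ_j 1 = 1`, does not lower the value and moves the point by at most `C ^
n` times the initial diameter, since `f_ω` contracts orbit closures. Hence consecutive iterates are
geometrically close (`near_iterate_succ`, `near_succ_iterate`), and completeness gives a limit `v`
(`exists_near_limit`).

`Z` is continuous for `Near` (`near_fuzzyOperator`), so `Z v` and `v` are arbitrarily close; both
being upper semicontinuous, they agree. The orbit condition survives because positive points of `v`
lie in `closure (orbit f z)` for some `z` of height `1` (`exists_mem_closure_orbit`), and that
closure contains a point where `v` is `1` (`exists_one_mem_closure_orbit`). The error bound is the
tail of the geometric series. -/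

theorem mem_fuzzySupp {u : X → I} {x : X} (h : 0 < u x) : x ∈ fuzzySupp u :=
  subset_closure h

theorem isClosed_le_apply {u : X → I} (hu : UpperSemicontinuous u) (α : I) :
    IsClosed {x | α ≤ u x} :=
  upperSemicontinuous_iff_isClosed_preimage.1 hu α

theorem isCompact_le_apply {u : X → I} (hu : UpperSemicontinuous u)
    (hc : IsCompact (fuzzySupp u)) {α : I} (hα : 0 < α) : IsCompact {x | α ≤ u x} :=
  hc.of_isClosed_subset (isClosed_le_apply hu α) fun _ hx => mem_fuzzySupp (hα.trans_le hx)

theorem upperSemicontinuous_of_isClosed {u : X → I}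
    (h : ∀ α : I, 0 < α → IsClosed {x | α ≤ u x}) : UpperSemicontinuous u := by
  refine upperSemicontinuous_iff_isClosed_preimage.2 fun α => ?_
  rcases eq_or_lt_of_le (unitInterval.nonneg' (t := α)) with h0 | h0
  · have : u ⁻¹' Ici α = univ := eq_univ_of_forall fun x => by
      change α ≤ u x
      rw [← h0]
      exact unitInterval.nonneg'
    rw [this]
    exact isClosed_univ
  · exact h α h0

/-- A positive supremum of an upper semicontinuous, compactly supported fuzzy set over a closed
set is attained. -/
theorem exists_eq_iSup_mem {u : X → I} (hu : UpperSemicontinuous u)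
    (hc : IsCompact (fuzzySupp u)) {S : Set X} (hS : IsClosed S) (h : 0 < ⨆ x ∈ S, u x) :
    ∃ x ∈ S, u x = ⨆ x ∈ S, u x := by
  obtain ⟨x₀, hx₀⟩ := lt_iSup_iff.1 h
  obtain ⟨hx₀S, hx₀⟩ := lt_iSup_iff.1 hx₀
  obtain ⟨x, hx, hmax⟩ := UpperSemicontinuousOn.exists_isMaxOn (f := u)
    (s := S ∩ fuzzySupp u) ⟨x₀, hx₀S, mem_fuzzySupp hx₀⟩ (hc.inter_left hS) (hu.upperSemicontinuousOn _)
  refine ⟨x, hx.1, le_antisymm (le_iSup₂ (f := fun x (_ : x ∈ S) => u x) x hx.1)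
    (iSup₂_le fun y hy => ?_)⟩
  rcases eq_or_lt_of_le (unitInterval.nonneg' (t := u y)) with h0 | h0
  · rw [← h0]
    exact unitInterval.nonneg'
  · exact hmax ⟨hy, mem_fuzzySupp h0⟩

/-- Every point of the hypograph of `u` is horizontally `ε`-close to the hypograph of `v`. -/
def Near (ε : ℝ) (u v : X → I) : Prop := ∀ x, ∃ y, u x ≤ v y ∧ dist x y ≤ ε

theorem near_of_pos {ε : ℝ} (hε : 0 ≤ ε) {u v : X → I}
    (h : ∀ x, 0 < u x → ∃ y, u x ≤ v y ∧ dist x y ≤ ε) : Near ε u v := by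
  intro x
  rcases eq_or_lt_of_le (unitInterval.nonneg' (t := u x)) with h0 | h0
  · exact ⟨x, by rw [← h0]; exact unitInterval.nonneg', by simpa using hε⟩
  · exact h x h0

theorem cut_zero (u : X → I) : cut u 0 = closure {x | 0 < u x} := by
  simp [cut, fuzzySupp]

theorem cut_of_pos (u : X → I) {α : I} (h : 0 < α) : cut u α = {x | α ≤ u x} := by
  simp [cut, h.ne']

theorem dInf_le_of_near {ε : ℝ} {u v : X → I} (h₁ : Near ε u v) (h₂ : Near ε v u) :
    dInf u v ≤ ENNReal.ofReal ε := by
  have key : ∀ {u v : X → I}, Near ε u v → ∀ x, ∃ y, u x ≤ v y ∧ edist x y ≤ ENNReal.ofReal ε :=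
    fun h x => (h x).imp fun y hy => ⟨hy.1, by
      rw [edist_dist]; exact ENNReal.ofReal_le_ofReal hy.2⟩
  refine iSup_le fun α => ?_
  rcases eq_or_lt_of_le (unitInterval.nonneg' (t := α)) with h0 | h0
  · rw [← h0, cut_zero, cut_zero, Metric.hausdorffEDist_closure]
    exact Metric.hausdorffEDist_le_of_mem_edist
      (fun x hx => (key h₁ x).imp fun y hy => ⟨lt_of_lt_of_le hx hy.1, hy.2⟩)
      (fun x hx => (key h₂ x).imp fun y hy => ⟨lt_of_lt_of_le hx hy.1, hy.2⟩)
  · rw [cut_of_pos u h0, cut_of_pos v h0]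
    exact Metric.hausdorffEDist_le_of_mem_edist
      (fun x hx => (key h₁ x).imp fun y hy => ⟨le_trans hx hy.1, hy.2⟩)
      (fun x hx => (key h₂ x).imp fun y hy => ⟨le_trans hx hy.1, hy.2⟩)

theorem dInf_triangle (u v w : X → I) : dInf u w ≤ dInf u v + dInf v w :=
  iSup_le fun α => Metric.hausdorffEDist_triangle.trans
    (add_le_add (le_iSup (fun α => Metric.hausdorffEDist (cut u α) (cut v α)) α)
      (le_iSup (fun α => Metric.hausdorffEDist (cut v α) (cut w α)) α))

theorem dInf_self (u : X → I) : dInf u u = 0 := by simp [dInf]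

/-- Points of the cut of `v` at level `u x` accumulate at `x`, and this cut is closed. -/
theorem le_of_forall_near {u v : X → I} (hv : UpperSemicontinuous v)
    (h : ∀ ε > 0, Near ε u v) : u ≤ v := by
  intro x
  have hx : x ∈ closure {y | u x ≤ v y} := Metric.mem_closure_iff.2 fun ε hε => by
    obtain ⟨y, hy, hd⟩ := h (ε / 2) (half_pos hε) x
    exact ⟨y, hy, by linarith⟩
  rwa [(isClosed_le_apply hv _).closure_eq] at hx

/-! ### Limits of sequences of fuzzy sets -/

/-- The horizontal dilation of a fuzzy set by closed balls of radius `r`. -/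
noncomputable def dilate (r : ℝ) (u : X → I) (x : X) : I := ⨆ y ∈ Metric.closedBall x r, u y

theorem le_dilate {r : ℝ} {u : X → I} {x y : X} (h : dist x y ≤ r) : u y ≤ dilate r u x :=
  le_iSup₂ (f := fun y (_ : y ∈ Metric.closedBall x r) => u y) y
    (by rwa [Metric.mem_closedBall, dist_comm])

theorem exists_of_dilate_pos {u : X → I} (hu : UpperSemicontinuous u)
    (hc : IsCompact (fuzzySupp u)) {r : ℝ} {x : X} (h : 0 < dilate r u x) :
    ∃ y, dist x y ≤ r ∧ u y = dilate r u x := by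
  obtain ⟨y, hy, h⟩ := exists_eq_iSup_mem hu hc Metric.isClosed_closedBall h
  exact ⟨y, by rwa [Metric.mem_closedBall, dist_comm] at hy, h⟩

/-- The supremum defining a positive value of the dilation is attained, so its cut is the closed
`r`-thickening of the compact cut of `u`. -/
theorem isClosed_le_dilate {u : X → I} (hu : UpperSemicontinuous u)
    (hc : IsCompact (fuzzySupp u)) {r : ℝ} (hr : 0 ≤ r) {α : I} (hα : 0 < α) :
    IsClosed {x | α ≤ dilate r u x} := by
  have : {x | α ≤ dilate r u x} = Metric.cthickening r {x | α ≤ u x} := by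
    rw [(isCompact_le_apply hu hc hα).cthickening_eq_biUnion_closedBall hr]
    ext x
    simp only [mem_ofPred_eq, mem_iUnion, Metric.mem_closedBall, exists_prop]
    constructor
    · intro h
      obtain ⟨y, hy, hy'⟩ := exists_of_dilate_pos hu hc (hα.trans_le h)
      exact ⟨y, hy' ▸ h, hy⟩
    · rintro ⟨y, hy, hd⟩
      exact hy.trans (le_dilate hd)
  rw [this]
  exact Metric.isClosed_cthickening

theorem dist_le_sub_of_step {x : ℕ → X} {r : ℕ → ℝ}
    (h : ∀ n, dist (x n) (x (n + 1)) ≤ r n - r (n + 1)) {n m : ℕ} (hnm : n ≤ m) :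
    dist (x n) (x m) ≤ r n - r m := by
  induction m, hnm using Nat.le_induction with
  | base => simp
  | succ m _ ih => linarith [dist_triangle (x n) (x m) (x (m + 1)), h m]

theorem exists_tendsto_of_step [CompleteSpace X] {x : ℕ → X} {r : ℕ → ℝ} (hr : ∀ n, 0 ≤ r n)
    (hr0 : Tendsto r atTop (𝓝 0)) (h : ∀ n, dist (x n) (x (n + 1)) ≤ r n - r (n + 1)) :
    ∃ a, Tendsto x atTop (𝓝 a) ∧ ∀ n, dist (x n) a ≤ r n := by
  have hle : ∀ n m, n ≤ m → dist (x n) (x m) ≤ r n := fun n m hnm => by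
    linarith [dist_le_sub_of_step h hnm, hr m]
  have hc : CauchySeq x := by
    refine cauchySeq_of_le_tendsto_0 (fun n => r n + r n) (fun n m N hn hm => ?_)
      (by simpa using hr0.add hr0)
    linarith [dist_triangle_left (x n) (x m) (x N), hle N n hn, hle N m hm]
  obtain ⟨a, ha⟩ := cauchySeq_tendsto_of_complete hc
  exact ⟨a, ha, fun n => le_of_tendsto (tendsto_const_nhds.dist ha)
    (eventually_atTop.2 ⟨n, fun m hm => hle n m hm⟩)⟩

theorem near_of_step {u : ℕ → X → I} {r : ℕ → ℝ}
    (h : ∀ n, Near (r n - r (n + 1)) (u (n + 1)) (u n)) {n m : ℕ} (hnm : n ≤ m) :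
    Near (r n - r m) (u m) (u n) := by
  induction m, hnm using Nat.le_induction with
  | base => exact fun x => ⟨x, le_rfl, by simp⟩
  | succ m _ ih =>
    intro x
    obtain ⟨y, hy, hd⟩ := h m x
    obtain ⟨z, hz, hd'⟩ := ih y
    exact ⟨z, hy.trans hz, by linarith [dist_triangle x y z]⟩

/-- Completeness. Writing the steps as differences of `r` makes them telescope, so the dilations of
`u n` by `r n` decrease with `n`; their infimum is the limit. -/
theorem exists_near_limit [CompleteSpace X] {u : ℕ → X → I} {r : ℕ → ℝ} (hr : ∀ n, 0 ≤ r n)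
    (hr0 : Tendsto r atTop (𝓝 0)) (hu : ∀ n, UpperSemicontinuous (u n))
    (hc : ∀ n, IsCompact (fuzzySupp (u n)))
    (h₁ : ∀ n, Near (r n - r (n + 1)) (u n) (u (n + 1)))
    (h₂ : ∀ n, Near (r n - r (n + 1)) (u (n + 1)) (u n)) :
    ∃ v : X → I, UpperSemicontinuous v ∧ IsCompact (fuzzySupp v) ∧
      (∀ n, Near (r n) (u n) v) ∧ ∀ n, Near (r n) v (u n) := by
  let v : X → I := fun x => ⨅ n, dilate (r n) (u n) x
  have hvu : ∀ n, Near (r n) v (u n) := fun n => near_of_pos (hr n) fun x hx => by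
    have hle : v x ≤ dilate (r n) (u n) x := iInf_le _ n
    obtain ⟨y, hy, h⟩ := exists_of_dilate_pos (hu n) (hc n) (hx.trans_le hle)
    exact ⟨y, h ▸ hle, hy⟩
  have hv : UpperSemicontinuous v := upperSemicontinuous_of_isClosed fun α hα => by
    have : {x | α ≤ v x} = ⋂ n, {x | α ≤ dilate (r n) (u n) x} := by
      ext x
      simp [v, le_iInf_iff]
    rw [this]
    exact isClosed_iInter fun n => isClosed_le_dilate (hu n) (hc n) (hr n) hα
  have hanti : ∀ n m x, n ≤ m → dilate (r m) (u m) x ≤ dilate (r n) (u n) x :=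
    fun n m x hnm => iSup₂_le fun y hy => by
      obtain ⟨z, hz, hd⟩ := near_of_step h₂ hnm y
      rw [Metric.mem_closedBall, dist_comm] at hy
      exact hz.trans (le_dilate (by linarith [dist_triangle x y z]))
  refine ⟨v, hv, ?_, fun n x => ?_, hvu⟩
  · refine isCompact_iff_totallyBounded_isComplete.2 ⟨?_, isClosed_closure.isComplete⟩
    -- An `ε / 2`-net of the support of a late `u n` is an `ε`-net of the points where `v` is
    -- positive.
    refine TotallyBounded.closure (Metric.totallyBounded_iff.2 fun ε hε => ?_)
    obtain ⟨n, hn⟩ := (hr0.eventually (gt_mem_nhds (half_pos hε))).exists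
    obtain ⟨t, ht, hsub⟩ := Metric.totallyBounded_iff.1 (hc n).totallyBounded (ε / 2) (half_pos hε)
    refine ⟨t, ht, fun x hx => ?_⟩
    obtain ⟨y, hy, hd⟩ := hvu n x
    have := hsub (mem_fuzzySupp (lt_of_lt_of_le hx hy))
    simp only [mem_iUnion, Metric.mem_ball, exists_prop] at this ⊢
    obtain ⟨z, hz, hyz⟩ := this
    exact ⟨z, hz, by linarith [dist_triangle x y z]⟩
  · choose g hg hd using h₁
    -- Following the matches from `x` gives a convergent sequence along which heights never drop;
    -- its limit is the point sought.
    let s : ℕ → X := fun k => Nat.rec x (fun k y => g (n + k) y) k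
    have hs : ∀ k, u n x ≤ u (n + k) (s k) := by
      intro k
      induction k with
      | zero => exact le_rfl
      | succ k ih => exact ih.trans (hg (n + k) (s k))
    obtain ⟨a, -, ha⟩ := exists_tendsto_of_step (x := s) (r := fun k => r (n + k))
      (fun k => hr _) (by simpa only [add_comm n] using (tendsto_add_atTop_iff_nat n).2 hr0)
      (fun k => hd (n + k) (s k))
    refine ⟨a, le_iInf fun m => ?_, ha 0⟩
    refine le_trans ?_ (hanti m (n + m) a (Nat.le_add_left m n))
    exact (hs m).trans (le_dilate (by rw [dist_comm]; exact ha m))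

end FuzzySets

/-! ### The fuzzy operator -/

section Operator

/-- Right-continuity puts the infimum of `{t | α ≤ ρ t}` into that set, and `ρ 0 = 0` keeps it
positive. -/
theorem exists_setOf_le_eq_Ici {ρ : I → I} (hρ : IsNdrc ρ) (h0 : ρ 0 = 0) {α : I} (hα : 0 < α)
    (h1 : α ≤ ρ 1) : ∃ β, 0 < β ∧ ∀ t, α ≤ ρ t ↔ β ≤ t := by
  let S : Set I := {t | α ≤ ρ t}
  have hS : sInf S ∈ S := by
    by_contra hn
    have hn : ρ (sInf S) < α := not_le.1 hn
    have hlt : sInf S < 1 := lt_of_le_of_ne unitInterval.le_one' fun h =>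
      absurd h1 (not_le.2 (h ▸ hn))
    have hev := (hρ.rightCont (sInf S)).eventually (gt_mem_nhds hn)
    obtain ⟨c, hc, hsub⟩ := (mem_nhdsGE_iff_exists_Ico_subset' hlt).1 hev
    obtain ⟨t, ht, htc⟩ := sInf_lt_iff.1 (show sInf S < c from hc)
    have hlt : ρ t < α := hsub ⟨sInf_le ht, htc⟩
    exact not_le.2 hlt ht
  refine ⟨sInf S, ?_, fun t => ⟨fun h => sInf_le h, fun h => le_trans hS (hρ.monotone h)⟩⟩
  refine lt_of_le_of_ne unitInterval.nonneg' fun h => ?_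
  have : α ≤ ρ (sInf S) := hS
  rw [← h, h0] at this
  exact absurd hα (not_lt.2 this)

variable {X ι : Type*}

theorem le_fuzzyOperator (f : ι → X → X) {ρ : ι → I → I} (hρ : IsAdmissible ρ) (u : X → I)
    (i : ι) (x : X) : ρ i (u x) ≤ fuzzyOperator f ρ u (f i x) := by
  have h : u x ≤ zadeh (f i) u (f i x) :=
    le_iSup₂ (f := fun z (_ : f i z = f i x) => u z) x rfl
  exact ((hρ.ndrc i).monotone h).trans (le_iSup (fun j => ρ j (zadeh (f j) u (f i x))) i)

variable [MetricSpace X]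

/-- The maximum over `ι` is attained by finiteness, and the supremum over the closed fibre by upper
semicontinuity and compactness; positivity excludes the default value `0` of an empty fibre. -/
theorem exists_fuzzyOperator_eq [Finite ι] {f : ι → X → X} (hf : ∀ i, Continuous (f i))
    {ρ : ι → I → I} (hρ : IsAdmissible ρ) {u : X → I} (hu : UpperSemicontinuous u)
    (hc : IsCompact (fuzzySupp u)) {y : X} (hy : 0 < fuzzyOperator f ρ u y) :
    ∃ i x, f i x = y ∧ fuzzyOperator f ρ u y = ρ i (u x) := by
  have : Nonempty ι := ⟨hρ.map_one.choose⟩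
  obtain ⟨i, hi⟩ := exists_eq_ciSup_of_finite (f := fun i => ρ i (zadeh (f i) u y))
  have hi : ρ i (zadeh (f i) u y) = fuzzyOperator f ρ u y := hi
  have hpos : 0 < zadeh (f i) u y := by
    refine lt_of_le_of_ne unitInterval.nonneg' fun h => ?_
    rw [← hi, ← h, hρ.map_zero] at hy
    exact lt_irrefl _ hy
  obtain ⟨x, hx, hux⟩ := exists_eq_iSup_mem hu hc
    (isClosed_singleton.preimage (hf i) : IsClosed (f i ⁻¹' {y})) hpos
  have hux : u x = zadeh (f i) u y := hux
  exact ⟨i, x, hx, by rw [hux, hi]⟩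

theorem pos_of_map_pos {ρ : ι → I → I} (hρ : IsAdmissible ρ) {i : ι} {t : I} (h : 0 < ρ i t) :
    0 < t := by
  refine lt_of_le_of_ne unitInterval.nonneg' fun h0 => ?_
  rw [← h0, hρ.map_zero] at h
  exact lt_irrefl _ h

theorem isCompact_fractalOperator [Finite ι] {f : ι → X → X} (hf : ∀ i, Continuous (f i))
    {K : Set X} (hK : IsCompact K) : IsCompact (fractalOperator f K) :=
  isCompact_iUnion fun i => hK.image (hf i)

theorem isCompact_fuzzySupp_fuzzyOperator [Finite ι] {f : ι → X → X}
    (hf : ∀ i, Continuous (f i)) {ρ : ι → I → I} (hρ : IsAdmissible ρ) {u : X → I}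
    (hu : UpperSemicontinuous u) (hc : IsCompact (fuzzySupp u)) :
    IsCompact (fuzzySupp (fuzzyOperator f ρ u)) := by
  have hK := isCompact_fractalOperator hf hc
  refine hK.of_isClosed_subset isClosed_closure (closure_minimal (fun y hy => ?_) hK.isClosed)
  have hy : 0 < fuzzyOperator f ρ u y := hy
  obtain ⟨i, x, rfl, h⟩ := exists_fuzzyOperator_eq hf hρ hu hc hy
  exact mem_iUnion.2 ⟨i, x, mem_fuzzySupp (pos_of_map_pos hρ (h ▸ hy)), rfl⟩

theorem upperSemicontinuous_fuzzyOperator [Finite ι] {f : ι → X → X}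
    (hf : ∀ i, Continuous (f i)) {ρ : ι → I → I} (hρ : IsAdmissible ρ) {u : X → I}
    (hu : UpperSemicontinuous u) (hc : IsCompact (fuzzySupp u)) :
    UpperSemicontinuous (fuzzyOperator f ρ u) := by
  refine upperSemicontinuous_of_isClosed fun α hα => ?_
  have : {y | α ≤ fuzzyOperator f ρ u y} = ⋃ i, f i '' {x | α ≤ ρ i (u x)} := by
    ext y
    simp only [mem_ofPred_eq, mem_iUnion, mem_image]
    constructor
    · intro h
      obtain ⟨i, x, hx, hy⟩ := exists_fuzzyOperator_eq hf hρ hu hc (hα.trans_le h)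
      exact ⟨i, x, hy ▸ h, hx⟩
    · rintro ⟨i, x, hx, rfl⟩
      exact hx.trans (le_fuzzyOperator f hρ u i x)
  rw [this]
  refine (isCompact_iUnion fun i => IsCompact.image ?_ (hf i)).isClosed
  by_cases h1 : α ≤ ρ i 1
  · obtain ⟨β, hβ, h⟩ := exists_setOf_le_eq_Ici (hρ.ndrc i) (hρ.map_zero i) hα h1
    simp only [h]
    exact isCompact_le_apply hu hc hβ
  · have : {x | α ≤ ρ i (u x)} = ∅ := eq_empty_of_forall_notMem fun x hx =>
      h1 (le_trans hx ((hρ.ndrc i).monotone unitInterval.le_one'))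
    rw [this]
    exact isCompact_empty

/-- Continuity of the fuzzy operator at `v`, in both directions of `Near`. -/
theorem near_fuzzyOperator [Finite ι] {f : ι → X → X} (hf : ∀ i, Continuous (f i))
    {ρ : ι → I → I} (hρ : IsAdmissible ρ) {v : X → I} (hv : UpperSemicontinuous v)
    (hc : IsCompact (fuzzySupp v)) {ε : ℝ} (hε : 0 < ε) :
    ∃ δ > 0, ∀ u : X → I, UpperSemicontinuous u → IsCompact (fuzzySupp u) →
      (Near δ v u → Near ε (fuzzyOperator f ρ v) (fuzzyOperator f ρ u)) ∧
      (Near δ u v → Near ε (fuzzyOperator f ρ u) (fuzzyOperator f ρ v)) := by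
  -- Uniform continuity around a compact set needs only one of the two points in `fuzzySupp v`, so
  -- `δ` does not depend on `u`.
  have hev : ∀ᶠ p : X × X in uniformity X,
      ∀ i, p.1 ∈ fuzzySupp v → (f i p.1, f i p.2) ∈ {q : X × X | dist q.1 q.2 < ε} :=
    eventually_all.2 fun i => hc.uniformContinuousAt_of_continuousAt (f i)
      (fun a _ => (hf i).continuousAt) (Metric.dist_mem_uniformity hε)
  obtain ⟨δ, hδ, h⟩ := Metric.mem_uniformity_dist.1 hev
  have h : ∀ x y, dist x y < δ → ∀ i, x ∈ fuzzySupp v → dist (f i x) (f i y) < ε :=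
    fun x y hd => h hd
  refine ⟨δ / 2, half_pos hδ, fun u hu huc => ⟨fun hn => ?_, fun hn => ?_⟩⟩
  · refine near_of_pos hε.le fun y hy => ?_
    obtain ⟨i, x, rfl, hx⟩ := exists_fuzzyOperator_eq hf hρ hv hc hy
    obtain ⟨z, hz, hd⟩ := hn x
    refine ⟨f i z, ?_, (h x z (by linarith) i (mem_fuzzySupp (pos_of_map_pos hρ (hx ▸ hy)))).le⟩
    rw [hx]
    exact ((hρ.ndrc i).monotone hz).trans (le_fuzzyOperator f hρ u i z)
  · refine near_of_pos hε.le fun y hy => ?_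
    obtain ⟨i, x, rfl, hx⟩ := exists_fuzzyOperator_eq hf hρ hu huc hy
    obtain ⟨z, hz, hd⟩ := hn x
    have hpos : 0 < u x := pos_of_map_pos hρ (hx ▸ hy)
    refine ⟨f i z, ?_, ?_⟩
    · rw [hx]
      exact ((hρ.ndrc i).monotone hz).trans (le_fuzzyOperator f hρ v i z)
    · rw [dist_comm] at hd ⊢
      exact (h z x (by linarith) i (mem_fuzzySupp (hpos.trans_le hz))).le

end Operator

/-! ### Words, orbits and contraction on orbit closures. -/

section Words

variable {X ι : Type*}

theorem wordMap_append (f : ι → X → X) (ω η : List ι) (x : X) :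
    wordMap f (ω ++ η) x = wordMap f ω (wordMap f η x) :=
  List.foldr_append

theorem wordMap_mem_orbit (f : ι → X → X) (ω : List ι) {w x : X} (hx : x ∈ orbit f w) :
    wordMap f ω x ∈ orbit f w := by
  obtain ⟨η, rfl⟩ := hx
  exact ⟨ω ++ η, wordMap_append f ω η w⟩

theorem self_mem_orbit (f : ι → X → X) (x : X) : x ∈ orbit f x := ⟨[], rfl⟩

theorem monotone_wordMap {ρ : ι → I → I} (hρ : IsAdmissible ρ) (ω : List ι) :
    Monotone (wordMap ρ ω) := by
  induction ω with
  | nil => exact monotone_id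
  | cons i ω ih => exact fun s t h => (hρ.ndrc i).monotone (ih h)

theorem wordMap_zero {ρ : ι → I → I} (hρ : IsAdmissible ρ) (ω : List ι) :
    wordMap ρ ω 0 = 0 := by
  induction ω with
  | nil => rfl
  | cons i ω ih => exact (congrArg (ρ i) ih).trans (hρ.map_zero i)

theorem pos_of_wordMap_pos {ρ : ι → I → I} (hρ : IsAdmissible ρ) {ω : List ι} {t : I}
    (h : 0 < wordMap ρ ω t) : 0 < t := by
  refine lt_of_le_of_ne unitInterval.nonneg' fun h0 => ?_
  rw [← h0, wordMap_zero hρ] at h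
  exact lt_irrefl _ h

theorem wordMap_replicate_one {ρ : ι → I → I} {i : ι} (hi : ρ i 1 = 1) (n : ℕ) :
    wordMap ρ (List.replicate n i) 1 = 1 := by
  induction n with
  | zero => rfl
  | succ n ih => exact (congrArg (ρ i) ih).trans hi

theorem le_iterate_fuzzyOperator (f : ι → X → X) {ρ : ι → I → I}
    (hρ : IsAdmissible ρ) (u : X → I) (ω : List ι) (x : X) :
    wordMap ρ ω (u x) ≤ (fuzzyOperator f ρ)^[ω.length] u (wordMap f ω x) := by
  induction ω with
  | nil => exact le_rfl
  | cons i ω ih =>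
    rw [List.length_cons, Function.iterate_succ_apply']
    exact ((hρ.ndrc i).monotone ih).trans (le_fuzzyOperator f hρ _ i _)

variable [MetricSpace X]

theorem continuous_wordMap {f : ι → X → X} (hf : ∀ i, Continuous (f i)) (ω : List ι) :
    Continuous (wordMap f ω) := by
  induction ω with
  | nil => exact continuous_id
  | cons i ω ih => exact (hf i).comp ih

theorem wordMap_mem_closure_orbit {f : ι → X → X} (hf : ∀ i, Continuous (f i)) (ω : List ι)
    {w x : X} (hx : x ∈ closure (orbit f w)) : wordMap f ω x ∈ closure (orbit f w) :=
  map_mem_closure (continuous_wordMap hf ω) hx fun _ h => wordMap_mem_orbit f ω h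

/-- The contraction inequality is a closed condition on pairs. -/
theorem IsOrbitalContractive.dist_le {f : ι → X → X} {C : ℝ} (hf : IsOrbitalContractive f C)
    {w x y : X} (hx : x ∈ closure (orbit f w)) (hy : y ∈ closure (orbit f w)) (i : ι) :
    dist (f i x) (f i y) ≤ C * dist x y := by
  have hcl : IsClosed {p : X × X | dist (f i p.1) (f i p.2) ≤ C * dist p.1 p.2} := by
    have := hf.continuous i
    exact isClosed_le (by fun_prop) (by fun_prop)
  have hsub : orbit f w ×ˢ orbit f w ⊆ {p : X × X | dist (f i p.1) (f i p.2) ≤ C * dist p.1 p.2} :=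
    fun p hp => hf.contract w i p.1 hp.1 p.2 hp.2
  have hmem : (x, y) ∈ closure (orbit f w ×ˢ orbit f w) := by
    rw [closure_prod_eq]
    exact ⟨hx, hy⟩
  exact closure_minimal hsub hcl hmem

theorem IsOrbitalContractive.dist_wordMap_le {f : ι → X → X} {C : ℝ}
    (hf : IsOrbitalContractive f C) {w x y : X} (hx : x ∈ closure (orbit f w))
    (hy : y ∈ closure (orbit f w)) (ω : List ι) :
    dist (wordMap f ω x) (wordMap f ω y) ≤ C ^ ω.length * dist x y := by
  induction ω with
  | nil => simp [wordMap]
  | cons i ω ih =>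
    calc dist (f i (wordMap f ω x)) (f i (wordMap f ω y))
        ≤ C * dist (wordMap f ω x) (wordMap f ω y) :=
          hf.dist_le (wordMap_mem_closure_orbit hf.continuous ω hx)
            (wordMap_mem_closure_orbit hf.continuous ω hy) i
      _ ≤ C * (C ^ ω.length * dist x y) := mul_le_mul_of_nonneg_left ih hf.nonneg
      _ = C ^ (i :: ω).length * dist x y := by rw [List.length_cons]; ring

/-- Orbits have bounded diameter, in terms of the first displacements. -/
theorem IsOrbitalContractive.dist_wordMap_self_le {f : ι → X → X} {C : ℝ}
    (hf : IsOrbitalContractive f C) {z : X} {D : ℝ} (hD : 0 ≤ D) (h : ∀ i, dist (f i z) z ≤ D)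
    (ω : List ι) : dist (wordMap f ω z) z ≤ D / (1 - C) := by
  have h1 : 0 < 1 - C := by linarith [hf.lt_one]
  induction ω with
  | nil => simpa [wordMap] using div_nonneg hD h1.le
  | cons i ω ih =>
    have hz := self_mem_orbit f z
    have h2 := hf.contract z i _ (wordMap_mem_orbit f ω hz) z hz
    have h3 : C * dist (wordMap f ω z) z ≤ C * (D / (1 - C)) :=
      mul_le_mul_of_nonneg_left ih hf.nonneg
    -- `D / (1 - C)` is the fixed point of `t ↦ C * t + D`, which makes the induction close.
    have h4 : C * (D / (1 - C)) + D = D / (1 - C) := by field_simp; ring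
    calc dist (f i (wordMap f ω z)) z ≤ dist (f i (wordMap f ω z)) (f i z) + dist (f i z) z :=
          dist_triangle _ _ _
      _ ≤ D / (1 - C) := by linarith [h i]

end Words

/-! ### The geometric error bound. -/

section ErrorBound

variable {X ι : Type*} [MetricSpace X] {f : ι → X → X} {C : ℝ} {u : X → I}

/-- The diameter of `F_S(supp u) ∪ supp u`. -/
noncomputable def initialDiam (f : ι → X → X) (u : X → I) : ℝ :=
  Metric.diam (fractalOperator f (fuzzySupp u) ∪ fuzzySupp u)

theorem initialDiam_nonneg : 0 ≤ initialDiam f u := Metric.diam_nonneg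

/-- The error bound for the `n`-th iterate. -/
noncomputable def errorBound (f : ι → X → X) (C : ℝ) (u : X → I) (n : ℕ) : ℝ :=
  C ^ n / (1 - C) * initialDiam f u

theorem errorBound_nonneg (hf : IsOrbitalContractive f C) (n : ℕ) : 0 ≤ errorBound f C u n :=
  mul_nonneg (div_nonneg (pow_nonneg hf.nonneg n) (by linarith [hf.lt_one])) initialDiam_nonneg

/-- This lets `errorBound` play the role of `r` in `exists_near_limit`. -/
theorem errorBound_sub (hf : IsOrbitalContractive f C) (n : ℕ) :
    errorBound f C u n - errorBound f C u (n + 1) = C ^ n * initialDiam f u := by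
  have h1 : 1 - C ≠ 0 := by linarith [hf.lt_one]
  unfold errorBound
  field_simp
  ring

theorem tendsto_errorBound (hf : IsOrbitalContractive f C) :
    Tendsto (errorBound f C u) atTop (𝓝 0) := by
  have := ((tendsto_pow_atTop_nhds_zero_of_lt_one hf.nonneg hf.lt_one).div_const
    (1 - C)).mul_const (initialDiam f u)
  rw [zero_div, zero_mul] at this
  exact this

end ErrorBound

/-! ### Iterates of the fuzzy operator, their limit and the fixed point. -/

section Iterates

variable {X ι : Type*} [MetricSpace X] [Finite ι] {f : ι → X → X} {ρ : ι → I → I} {C : ℝ}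
  {u v : X → I}

/-- An index with `ρ j 1 = 1` carries height `1` along `f j`, and orbit closures are invariant under
every map, so the witnessing orbit is kept. -/
theorem mapsTo_fuzzyOperator (hf : IsOrbitalContractive f C) (hρ : IsAdmissible ρ) :
    MapsTo (fuzzyOperator f ρ) (orbitalNormalCompactUsc f) (orbitalNormalCompactUsc f) := by
  rintro u ⟨⟨⟨⟨x₀, hx₀⟩, hc⟩, horb⟩, hu⟩
  obtain ⟨j, hj⟩ := hρ.map_one
  have hone : ∀ {y}, u y = 1 → fuzzyOperator f ρ u (f j y) = 1 := fun {y} hy => by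
    refine le_antisymm unitInterval.le_one' ?_
    have := le_fuzzyOperator f hρ u j y
    rwa [hy, hj] at this
  refine ⟨⟨⟨⟨_, hone hx₀⟩, isCompact_fuzzySupp_fuzzyOperator hf.continuous hρ hu hc⟩, ?_⟩,
    upperSemicontinuous_fuzzyOperator hf.continuous hρ hu hc⟩
  intro y hy
  obtain ⟨i, x, rfl, hx⟩ := exists_fuzzyOperator_eq hf.continuous hρ hu hc hy
  obtain ⟨w, z, hz, hxw, hz1⟩ := horb x (pos_of_map_pos hρ (hx ▸ hy))
  exact ⟨w, f j z, wordMap_mem_closure_orbit hf.continuous [j] hz,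
    wordMap_mem_closure_orbit hf.continuous [i] hxw, hone hz1⟩

theorem iterate_fuzzyOperator_mem (hf : IsOrbitalContractive f C) (hρ : IsAdmissible ρ)
    (hu : u ∈ orbitalNormalCompactUsc f) (n : ℕ) :
    (fuzzyOperator f ρ)^[n] u ∈ orbitalNormalCompactUsc f :=
  (mapsTo_fuzzyOperator hf hρ).iterate n hu

theorem exists_iterate_fuzzyOperator_eq (hf : IsOrbitalContractive f C) (hρ : IsAdmissible ρ)
    (hu : u ∈ orbitalNormalCompactUsc f) {n : ℕ} {y : X}
    (hy : 0 < (fuzzyOperator f ρ)^[n] u y) :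
    ∃ ω : List ι, ω.length = n ∧ ∃ x, wordMap f ω x = y ∧
      (fuzzyOperator f ρ)^[n] u y = wordMap ρ ω (u x) := by
  induction n generalizing y with
  | zero => exact ⟨[], rfl, y, rfl, rfl⟩
  | succ n ih =>
    rw [Function.iterate_succ_apply'] at hy ⊢
    have hn := iterate_fuzzyOperator_mem hf hρ hu n
    obtain ⟨i, x, rfl, hx⟩ := exists_fuzzyOperator_eq hf.continuous hρ hn.2 hn.1.1.2 hy
    obtain ⟨ω, rfl, z, rfl, hz⟩ := ih (pos_of_map_pos hρ (hx ▸ hy))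
    exact ⟨i :: ω, rfl, z, rfl, by rw [hx, hz]; rfl⟩

theorem isBounded_initial (hf : ∀ i, Continuous (f i)) (hu : u ∈ orbitalNormalCompactUsc f) :
    Bornology.IsBounded (fractalOperator f (fuzzySupp u) ∪ fuzzySupp u) :=
  ((isCompact_fractalOperator hf hu.1.1.2).union hu.1.1.2).isBounded

theorem dist_le_initialDiam (hf : ∀ i, Continuous (f i)) (hu : u ∈ orbitalNormalCompactUsc f)
    {x y : X} (hx : 0 < u x) (hy : 0 < u y) : dist x y ≤ initialDiam f u :=
  Metric.dist_le_diam_of_mem (isBounded_initial hf hu) (Or.inr (mem_fuzzySupp hx))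
    (Or.inr (mem_fuzzySupp hy))

theorem dist_map_le_initialDiam (hf : ∀ i, Continuous (f i))
    (hu : u ∈ orbitalNormalCompactUsc f) {x y : X} (hx : 0 < u x) (hy : 0 < u y) (i : ι) :
    dist (f i x) y ≤ initialDiam f u :=
  Metric.dist_le_diam_of_mem (isBounded_initial hf hu)
    (Or.inl (mem_iUnion.2 ⟨i, x, mem_fuzzySupp hx, rfl⟩)) (Or.inr (mem_fuzzySupp hy))

theorem near_iterate_succ (hf : IsOrbitalContractive f C) (hρ : IsAdmissible ρ)
    (hu : u ∈ orbitalNormalCompactUsc f) (n : ℕ) :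
    Near (C ^ n * initialDiam f u) ((fuzzyOperator f ρ)^[n] u)
      ((fuzzyOperator f ρ)^[n + 1] u) := by
  have hC := pow_nonneg hf.nonneg n
  refine near_of_pos (mul_nonneg hC initialDiam_nonneg) fun y hy => ?_
  obtain ⟨ω, hω, x, rfl, hx⟩ := exists_iterate_fuzzyOperator_eq hf hρ hu hy
  obtain ⟨j, hj⟩ := hρ.map_one
  have hxpos : 0 < u x := pos_of_wordMap_pos hρ (hx ▸ hy)
  obtain ⟨w, z, hz, hxw, hz1⟩ := hu.1.2 x hxpos
  -- `Z u` is `1` at `f j z`, so applying `ρ_ω` there gives at least the height `ρ_ω (u x)`.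
  refine ⟨wordMap f ω (f j z), ?_, ?_⟩
  · rw [hx, Function.iterate_succ_apply, ← hω]
    refine le_trans (monotone_wordMap hρ ω ?_) (le_iterate_fuzzyOperator f hρ _ ω _)
    refine le_trans ?_ (le_fuzzyOperator f hρ u j z)
    rw [hz1, hj]
    exact unitInterval.le_one'
  · refine (hf.dist_wordMap_le hxw
      (wordMap_mem_closure_orbit hf.continuous [j] hz : f j z ∈ _) ω).trans ?_
    rw [hω, dist_comm]
    exact mul_le_mul_of_nonneg_left (dist_map_le_initialDiam hf.continuous hu
      (hz1 ▸ one_pos : 0 < u z) hxpos j) hC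

theorem near_succ_iterate (hf : IsOrbitalContractive f C) (hρ : IsAdmissible ρ)
    (hu : u ∈ orbitalNormalCompactUsc f) (n : ℕ) :
    Near (C ^ n * initialDiam f u) ((fuzzyOperator f ρ)^[n + 1] u)
      ((fuzzyOperator f ρ)^[n] u) := by
  have hC := pow_nonneg hf.nonneg n
  refine near_of_pos (mul_nonneg hC initialDiam_nonneg) fun y hy => ?_
  -- Peeling off the innermost application leaves a word of length `n` acting on `f i p`, which is
  -- then replaced by `z`.
  rw [Function.iterate_succ_apply] at hy ⊢
  obtain ⟨ω, hω, x, rfl, hx⟩ :=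
    exists_iterate_fuzzyOperator_eq hf hρ (mapsTo_fuzzyOperator hf hρ hu) hy
  have hZ : 0 < fuzzyOperator f ρ u x := pos_of_wordMap_pos hρ (hx ▸ hy)
  obtain ⟨i, p, rfl, hp⟩ := exists_fuzzyOperator_eq hf.continuous hρ hu.2 hu.1.1.2 hZ
  have hpos : 0 < u p := pos_of_map_pos hρ (hp ▸ hZ)
  obtain ⟨w, z, hz, hpw, hz1⟩ := hu.1.2 p hpos
  refine ⟨wordMap f ω z, ?_, ?_⟩
  · rw [hx, ← hω]
    refine le_trans (monotone_wordMap hρ ω ?_) (le_iterate_fuzzyOperator f hρ _ ω _)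
    rw [hz1]
    exact unitInterval.le_one'
  · refine (hf.dist_wordMap_le
      (wordMap_mem_closure_orbit hf.continuous [i] hpw : f i p ∈ _) hz ω).trans ?_
    rw [hω]
    exact mul_le_mul_of_nonneg_left (dist_map_le_initialDiam hf.continuous hu
      hpos (by rw [hz1]; exact one_pos) i) hC

/-- Points of a limit of the iterates of `u` lie in the closure of the orbit of a point where `u`
is `1`. -/
theorem exists_mem_closure_orbit (hf : IsOrbitalContractive f C) (hρ : IsAdmissible ρ)
    (hu : u ∈ orbitalNormalCompactUsc f) {r : ℕ → ℝ} (hr : Tendsto r atTop (𝓝 0))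
    (hv : ∀ n, Near (r n) v ((fuzzyOperator f ρ)^[n] u)) {x : X} (hx : 0 < v x) :
    ∃ z, u z = 1 ∧ x ∈ closure (orbit f z) := by
  have key : ∀ n, ∃ ω : List ι, ω.length = n ∧ ∃ z, u z = 1 ∧
      dist x (wordMap f ω z) ≤ r n + C ^ n * initialDiam f u := by
    intro n
    obtain ⟨y, hy, hd⟩ := hv n x
    have hypos := hx.trans_le hy
    obtain ⟨ω, hω, p, rfl, hp⟩ := exists_iterate_fuzzyOperator_eq hf hρ hu hypos
    have hppos : 0 < u p := pos_of_wordMap_pos hρ (hp ▸ hypos)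
    obtain ⟨w, z, hz, hpw, hz1⟩ := hu.1.2 p hppos
    refine ⟨ω, hω, z, hz1, ?_⟩
    have h1 := hf.dist_wordMap_le hpw hz ω
    rw [hω] at h1
    have h2 := mul_le_mul_of_nonneg_left (dist_le_initialDiam hf.continuous hu hppos
      (by rw [hz1]; exact one_pos : 0 < u z)) (pow_nonneg hf.nonneg n)
    linarith [dist_triangle x (wordMap f ω p) (wordMap f ω z)]
  choose ω hω z hz hd using key
  -- The base points of height `1` vary with `n`; compactness of the top cut gives a cluster point
  -- `a`, the required base point.
  obtain ⟨a, ha, φ, hφ, hlim⟩ := (isCompact_le_apply hu.2 hu.1.1.2 one_pos).tendsto_subseq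
    (fun n => (hz n).ge)
  refine ⟨a, le_antisymm unitInterval.le_one' ha, Metric.mem_closure_iff.2 fun ε hε => ?_⟩
  have hpow := tendsto_pow_atTop_nhds_zero_of_lt_one hf.nonneg hf.lt_one
  have hε3 : 0 < ε / 3 := by positivity
  have hM : Tendsto (fun m => C ^ m * (initialDiam f u / (1 - C))) atTop (𝓝 0) := by
    simpa using hpow.mul_const (initialDiam f u / (1 - C))
  obtain ⟨m, hm⟩ := (hM.eventually (gt_mem_nhds hε3)).exists
  have hD : Tendsto (fun n => r n + C ^ n * initialDiam f u) atTop (𝓝 0) := by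
    simpa using hr.add (hpow.mul_const (initialDiam f u))
  have hev₁ := hφ.tendsto_atTop.eventually (hD.eventually (gt_mem_nhds hε3))
  have hev₂ : ∀ᶠ k in atTop, ∀ η ∈ {η : List ι | η.length = m},
      dist (wordMap f η (z (φ k))) (wordMap f η a) < ε / 3 := by
    -- There are finitely many words of length `m`, so continuity at `a` is uniform over them.
    refine (List.finite_length_eq ι m).eventually_all.2 fun η _ => ?_
    exact (((continuous_wordMap hf.continuous η).tendsto a).comp hlim).eventually
      (Metric.ball_mem_nhds _ hε3)
  obtain ⟨k, hk₁, hk₂, hk₃⟩ :=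
    (hev₁.and (hev₂.and (hφ.tendsto_atTop.eventually (eventually_ge_atTop m)))).exists
  have hlen : ((ω (φ k)).take m).length = m := by
    rw [List.length_take, hω, min_eq_left hk₃]
  -- Keeping only the `m` outermost letters costs at most `C ^ m * (initialDiam f u / (1 - C))`. The
  -- thirds of `ε` pay for reaching the full word at `q`, truncating it, and moving `q` to `a`.
  refine ⟨wordMap f ((ω (φ k)).take m) a, wordMap_mem_orbit f _ (self_mem_orbit f a), ?_⟩
  have h1 := hd (φ k)
  have h2 := hk₂ _ hlen
  set q := z (φ k)
  have hq : 0 < u q := by rw [hz]; exact one_pos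
  have hq0 := self_mem_orbit f q
  have h3 := hf.dist_wordMap_le (subset_closure (wordMap_mem_orbit f ((ω (φ k)).drop m) hq0))
    (subset_closure hq0) ((ω (φ k)).take m)
  rw [← wordMap_append, List.take_append_drop, hlen] at h3
  have h4 := mul_le_mul_of_nonneg_left (hf.dist_wordMap_self_le initialDiam_nonneg
    (fun i => dist_map_le_initialDiam hf.continuous hu hq hq i) ((ω (φ k)).drop m))
    (pow_nonneg hf.nonneg m)
  linarith [dist_triangle4 x (wordMap f (ω (φ k)) q) (wordMap f ((ω (φ k)).take m) q)
    (wordMap f ((ω (φ k)).take m) a)]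

/-- If `ρ j 1 = 1`, the `k`-th iterate of `u` is `1` at `f_j^k z`. These points converge, and nearby
points where `v` is `1` have the same limit. -/
theorem exists_one_mem_closure_orbit [CompleteSpace X] (hf : IsOrbitalContractive f C)
    (hρ : IsAdmissible ρ) (hu : u ∈ orbitalNormalCompactUsc f) (hv : UpperSemicontinuous v)
    (h : ∀ n, Near (errorBound f C u n) ((fuzzyOperator f ρ)^[n] u) v) {z : X} (hz : u z = 1) :
    ∃ y ∈ closure (orbit f z), v y = 1 := by
  obtain ⟨j, hj⟩ := hρ.map_one
  let s : ℕ → X := fun k => wordMap f (List.replicate k j) z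
  have hz0 := self_mem_orbit f z
  have hzpos : 0 < u z := by rw [hz]; exact one_pos
  have hstep : ∀ k, dist (s k) (s (k + 1)) ≤ errorBound f C u k - errorBound f C u (k + 1) := by
    intro k
    have h1 := hf.dist_wordMap_le (subset_closure hz0)
      (subset_closure (wordMap_mem_orbit f [j] hz0)) (List.replicate k j)
    rw [← wordMap_append, ← List.replicate_succ', List.length_replicate] at h1
    rw [errorBound_sub hf]
    refine h1.trans (mul_le_mul_of_nonneg_left ?_ (pow_nonneg hf.nonneg k))
    rw [dist_comm]
    exact dist_map_le_initialDiam hf.continuous hu hzpos hzpos j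
  obtain ⟨y, hy, -⟩ := exists_tendsto_of_step (errorBound_nonneg hf) (tendsto_errorBound hf) hstep
  refine ⟨y, mem_closure_of_tendsto hy
    (Eventually.of_forall fun k => wordMap_mem_orbit f _ hz0), ?_⟩
  have hs : ∀ k, 1 ≤ (fuzzyOperator f ρ)^[k] u (s k) := fun k => by
    have := le_iterate_fuzzyOperator f hρ u (List.replicate k j) z
    rwa [hz, wordMap_replicate_one hj, List.length_replicate] at this
  choose t ht hd using fun k => h k (s k)
  have htlim : Tendsto t atTop (𝓝 y) := by
    refine (tendsto_iff_of_dist ?_).1 hy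
    exact squeeze_zero (fun _ => dist_nonneg) hd (tendsto_errorBound hf)
  exact le_antisymm unitInterval.le_one' ((isClosed_le_apply hv 1).mem_of_tendsto htlim
    (Eventually.of_forall fun k => (hs k).trans (ht k)))

theorem exists_fixedPoint [CompleteSpace X] (hf : IsOrbitalContractive f C)
    (hρ : IsAdmissible ρ) (hu : u ∈ orbitalNormalCompactUsc f) :
    ∃ v ∈ orbitalNormalCompactUsc f, fuzzyOperator f ρ v = v ∧
      ∀ n, dInf ((fuzzyOperator f ρ)^[n] u) v ≤ ENNReal.ofReal (errorBound f C u n) := by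
  have hn := iterate_fuzzyOperator_mem hf hρ hu
  obtain ⟨v, hv, hvc, huv, hvu⟩ := exists_near_limit (errorBound_nonneg hf)
    (tendsto_errorBound (u := u) hf) (fun n => (hn n).2) (fun n => (hn n).1.1.2)
    (fun n => by rw [errorBound_sub hf]; exact near_iterate_succ hf hρ hu n)
    (fun n => by rw [errorBound_sub hf]; exact near_succ_iterate hf hρ hu n)
  obtain ⟨x₀, hx₀⟩ := hu.1.1.1
  have hone := fun {z} => exists_one_mem_closure_orbit (z := z) hf hρ hu hv huv
  have hsmall : ∀ ε > 0, ∃ n, errorBound f C u n ≤ ε ∧ errorBound f C u (n + 1) ≤ ε :=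
    fun ε hε => by
      have h1 := (tendsto_errorBound (u := u) hf).eventually (ge_mem_nhds hε)
      exact (h1.and ((tendsto_add_atTop_nat 1).eventually h1)).exists
  have hmono : ∀ {a b : ℝ} {p q : X → I}, a ≤ b → Near a p q → Near b p q :=
    fun hab h x => (h x).imp fun y hy => ⟨hy.1, hy.2.trans hab⟩
  have htrans : ∀ {a b : ℝ} {p q s : X → I}, Near a p q → Near b q s → Near (a + b) p s :=
    fun h h' x => by
      obtain ⟨y, hy, hd⟩ := h x
      obtain ⟨z, hz, hd'⟩ := h' y
      exact ⟨z, hy.trans hz, (dist_triangle x y z).trans (add_le_add hd hd')⟩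
  refine ⟨v, ⟨⟨⟨?_, hvc⟩, fun x hx => ?_⟩, hv⟩, ?_,
    fun n => dInf_le_of_near (huv n) (hvu n)⟩
  · obtain ⟨y, -, hy⟩ := hone hx₀
    exact ⟨y, hy⟩
  · obtain ⟨z, hz, hxz⟩ := exists_mem_closure_orbit hf hρ hu (tendsto_errorBound hf) hvu hx
    obtain ⟨y, hy, hy1⟩ := hone hz
    exact ⟨z, y, hy, hxz, hy1⟩
  · have hboth : ∀ ε > 0, Near ε (fuzzyOperator f ρ v) v ∧ Near ε v (fuzzyOperator f ρ v) := by
      intro ε hε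
      obtain ⟨δ, hδ, h⟩ := near_fuzzyOperator hf.continuous hρ hv hvc (half_pos hε)
      -- Index `n` compares `Z v` with the next iterate, and index `n + 1` compares that iterate
      -- with `v`.
      obtain ⟨n, hn₁, hn₂⟩ := hsmall (min δ (ε / 2)) (lt_min hδ (half_pos hε))
      obtain ⟨h₁, h₂⟩ := h _ (hn n).2 (hn n).1.1.2
      have h₁ := h₁ (hmono (hn₁.trans (min_le_left _ _)) (hvu n))
      have h₂ := h₂ (hmono (hn₁.trans (min_le_left _ _)) (huv n))
      rw [← Function.iterate_succ_apply' (fuzzyOperator f ρ)] at h₁ h₂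
      have h₃ := hmono (hn₂.trans (min_le_right _ _)) (huv (n + 1))
      have h₄ := hmono (hn₂.trans (min_le_right _ _)) (hvu (n + 1))
      rw [← add_halves ε]
      exact ⟨htrans h₁ h₃, htrans h₄ h₂⟩
    exact le_antisymm (le_of_forall_near hv fun ε hε => (hboth ε hε).1)
      (le_of_forall_near (upperSemicontinuous_fuzzyOperator hf.continuous hρ hv hvc)
        fun ε hε => (hboth ε hε).2)

theorem dInf_iterate_le (hf : IsOrbitalContractive f C) (hρ : IsAdmissible ρ)
    (hu : u ∈ orbitalNormalCompactUsc f) {m n : ℕ} (hmn : m ≤ n) :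
    dInf ((fuzzyOperator f ρ)^[m] u) ((fuzzyOperator f ρ)^[n] u) ≤
      ENNReal.ofReal (errorBound f C u m - errorBound f C u n) := by
  induction n, hmn using Nat.le_induction with
  | base => simp [dInf_self]
  | succ n hmn ih =>
    have h1 := dInf_le_of_near (near_iterate_succ hf hρ hu n) (near_succ_iterate hf hρ hu n)
    refine (dInf_triangle _ _ _).trans ((add_le_add ih h1).trans ?_)
    have hmono : errorBound f C u n ≤ errorBound f C u m := by
      have : Antitone (errorBound f C u) := antitone_nat_of_succ_le fun k => by
        have := errorBound_sub (u := u) hf k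
        have := mul_nonneg (pow_nonneg hf.nonneg k) (initialDiam_nonneg (f := f) (u := u))
        linarith
      exact this hmn
    rw [← ENNReal.ofReal_add (sub_nonneg.2 hmono)
      (mul_nonneg (pow_nonneg hf.nonneg n) initialDiam_nonneg), ← errorBound_sub hf]
    exact ENNReal.ofReal_le_ofReal (by linarith)

/-- The estimate holds for any limit `v`, not just the constructed one: let `n → ∞` in the triangle
inequality through the `n`-th iterate. -/
theorem dInf_iterate_le_of_tendsto (hf : IsOrbitalContractive f C) (hρ : IsAdmissible ρ)
    (hu : u ∈ orbitalNormalCompactUsc f)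
    (hv : Tendsto (fun n : ℕ => dInf ((fuzzyOperator f ρ)^[n] u) v) atTop (𝓝 0)) (m : ℕ) :
    dInf ((fuzzyOperator f ρ)^[m] u) v ≤ ENNReal.ofReal (errorBound f C u m) := by
  have hlim : Tendsto (fun n : ℕ => ENNReal.ofReal (errorBound f C u m) +
      dInf ((fuzzyOperator f ρ)^[n] u) v) atTop (𝓝 (ENNReal.ofReal (errorBound f C u m))) := by
    simpa using tendsto_const_nhds.add hv
  refine ge_of_tendsto hlim (eventually_atTop.2 ⟨m, fun n hn => ?_⟩)
  refine (dInf_triangle _ _ _).trans (add_le_add_left ((dInf_iterate_le hf hρ hu hn).trans ?_) _)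
  exact ENNReal.ofReal_le_ofReal (by linarith [errorBound_nonneg (u := u) hf n])

end Iterates

end OrbitalFuzzy

theorem mainTheorem1 {X ι : Type*} [MetricSpace X] [CompleteSpace X] [Finite ι]
    (f : ι → X → X) (ρ : ι → unitInterval → unitInterval) (C : ℝ)
    (hf : OrbitalFuzzy.IsOrbitalContractive f C) (hρ : OrbitalFuzzy.IsAdmissible ρ) :
    OrbitalFuzzy.IsWeaklyPicardOn OrbitalFuzzy.dInf (OrbitalFuzzy.fuzzyOperator f ρ)
        (OrbitalFuzzy.orbitalNormalCompactUsc f) ∧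
      ∀ u ∈ OrbitalFuzzy.orbitalNormalCompactUsc f, ∀ v ∈ OrbitalFuzzy.orbitalNormalCompactUsc f,
        Filter.Tendsto
            (fun n : ℕ => OrbitalFuzzy.dInf ((OrbitalFuzzy.fuzzyOperator f ρ)^[n] u) v)
            Filter.atTop (nhds 0) →
          ∀ m : ℕ,
            OrbitalFuzzy.dInf ((OrbitalFuzzy.fuzzyOperator f ρ)^[m] u) v ≤
              ENNReal.ofReal (C ^ m / (1 - C) *
                Metric.diam (OrbitalFuzzy.fractalOperator f (OrbitalFuzzy.fuzzySupp u) ∪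
                  OrbitalFuzzy.fuzzySupp u)) := by
  refine ⟨⟨OrbitalFuzzy.mapsTo_fuzzyOperator hf hρ, fun u hu => ?_⟩, fun u hu v _ hv m =>
    OrbitalFuzzy.dInf_iterate_le_of_tendsto hf hρ hu hv m⟩
  obtain ⟨v, hv, hfix, hle⟩ := OrbitalFuzzy.exists_fixedPoint hf hρ hu
  refine ⟨v, hv, hfix, tendsto_of_tendsto_of_tendsto_of_le_of_le tendsto_const_nhds ?_
    (fun _ => zero_le) hle⟩
  simpa using ENNReal.tendsto_ofReal (OrbitalFuzzy.tendsto_errorBound (u := u) hf)
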